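/- For integers $n\ge k\ge 0$, let $S_{n,k}$ denote the join of a complete graph of order $k$ and an independent set of order $n-k$. A (finite, simple) graph $G$ is called $k$-degenerate if every nonempty subgraph of $G$ contains a vertex whose degree in that subgraph is at most $k$. Let $\mu(G)$ denote the largest eigenvalue of the adjacency matrix of $G$. Theorem. If $G$ is a $k$-degenerate graph of order $n\ge k$, then $\mu(G)<\mu(S_{n,k})$, unless $G=S_{n,k}$ (that is, unless $G$ is isomorphic to $S_{n,k}$). -/

import Mathlib

namespace DegenerateGraphs

/-- The join of two graphs: their disjoint union together with all edges between them. -/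
def join {V W : Type*} (G : SimpleGraph V) (H : SimpleGraph W) : SimpleGraph (V ⊕ W) :=
  SimpleGraph.sum G H ⊔ completeBipartiteGraph V W

/-- The graph `S_{n,k}`: the join of a complete graph of order `k` and an independent set of
order `n - k` (used for `k ≤ n`). -/
def S (n k : ℕ) : SimpleGraph (Fin k ⊕ Fin (n - k)) :=
  join (⊤ : SimpleGraph (Fin k)) (⊥ : SimpleGraph (Fin (n - k)))

/-- A graph is `k`-degenerate if every (nonempty, not necessarily induced) subgraph has a vertex
whose degree in the subgraph is at most `k`. -/
def IsDegenerate {V : Type*} (k : ℕ) (G : SimpleGraph V) : Prop :=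
  ∀ H : G.Subgraph, H.verts.Nonempty → ∃ v ∈ H.verts, (H.neighborSet v).encard ≤ k

open Classical in
/-- The set of real eigenvalues of the adjacency matrix of `G`. -/
def adjEigenvalues {V : Type*} [Fintype V] (G : SimpleGraph V) : Set ℝ :=
  {x | Module.End.HasEigenvalue (Matrix.toLin' (G.adjMatrix ℝ)) x}

/-- The largest eigenvalue `μ(G)` of the adjacency matrix of `G`. -/
noncomputable def mu {V : Type*} [Fintype V] (G : SimpleGraph V) : ℝ :=
  sSup (adjEigenvalues G)

/-- The supremum defining `mu` is a maximum as soon as there is a vertex. -/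
theorem isGreatest_mu {V : Type*} [Fintype V] [Nonempty V] (G : SimpleGraph V) :
    IsGreatest (adjEigenvalues G) (mu G) := by
  classical
  have hfin : (adjEigenvalues G).Finite := by
    unfold adjEigenvalues
    exact Module.End.finite_hasEigenvalue _
  have hne : (adjEigenvalues G).Nonempty := by
    have hA : (G.adjMatrix ℝ).IsHermitian := by
      ext i j
      simp [SimpleGraph.adjMatrix_apply, SimpleGraph.adj_comm]
    obtain ⟨i⟩ := ‹Nonempty V›
    refine ⟨hA.eigenvalues i, ?_⟩
    have h := hA.eigenvalues_mem_spectrum_real i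
    rw [← Matrix.spectrum_toLin', ← Module.End.hasEigenvalue_iff_mem_spectrum] at h
    unfold adjEigenvalues
    convert h
  exact ⟨hne.csSup_mem hfin, fun x hx => le_csSup hfin.bddAbove hx⟩

end DegenerateGraphs

namespace DegenerateGraphs

open Finset

/-! Write `j` for the degeneracy bound. Enlarge `G` to an edge-maximal graph `H`
(`exists_maximal_degenerate`) with adjacency matrix `A`: degrees are at least `j` and sum to `j (2n
- j - 1)`. The row sum of `A ^ 2 - (j - 1) A` at `w` is then `j (n - j)` minus the total excess `d v
- j` over the non-neighbours `v ≠ w`, hence at most `j (n - j)`. For `j < n`, `S n j` has an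
eigenvalue `r` with `r ^ 2 - (j - 1) r = j (n - j)`.

If `l = μ(G)` is at least `μ(S n j)`, the absolute values of an eigenvector of `G` give `y ≥ 0` with
`l y ≤ A y`. Summing over all vertices forces equality throughout (`equality_of_le_spectral`):
connectivity makes `y` positive, whence `G = H`, and no excess survives at a non-neighbour, which
determines the graph (`exists_clique_join_of_degree_eq`). -/

/-! ### Eigenvectors, and the graph `S n k` -/

open Classical in
theorem mem_adjEigenvalues_iff {V : Type*} [Fintype V] (G : SimpleGraph V) (x : ℝ) :
    x ∈ adjEigenvalues G ↔
      ∃ y : V → ℝ, y ≠ 0 ∧ ∀ v, ∑ w, (if G.Adj v w then y w else 0) = x * y v := by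
  have key : ∀ (y : V → ℝ) (v : V), Matrix.toLin' (G.adjMatrix ℝ) y v =
      ∑ w, (if G.Adj v w then y w else 0) := by
    intro y v
    simp [Matrix.mulVec, dotProduct, SimpleGraph.adjMatrix_apply]
  constructor
  · intro h
    obtain ⟨y, hy⟩ := Module.End.HasEigenvalue.exists_hasEigenvector h
    refine ⟨y, hy.2, fun v => ?_⟩
    rw [← key, hy.apply_eq_smul]
    simp
  · rintro ⟨y, hy0, hy⟩
    refine Module.End.hasEigenvalue_of_hasEigenvector (x := y) ⟨?_, hy0⟩
    rw [Module.End.mem_eigenspace_iff]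
    ext v
    rw [key, hy]
    simp

/-- A graph that is the join of a clique on `T` and an independent set on the complement of `T`
is isomorphic to `S n k`. -/
theorem nonempty_iso_S {V : Type*} [Fintype V] (G : SimpleGraph V) (n k : ℕ)
    (hn : Fintype.card V = n) (T : Finset V) (hT : #T = k)
    (h : ∀ u v, u ≠ v → (G.Adj u v ↔ u ∈ T ∨ v ∈ T)) : Nonempty (G ≃g S n k) := by
  classical
  have e1 : {v // v ∈ T} ≃ Fin k := T.equivFinOfCardEq hT
  have e2 : {v // ¬ v ∈ T} ≃ Fin (n - k) := by
    refine Fintype.equivFinOfCardEq ?_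
    rw [Fintype.card_subtype_compl, hn, Fintype.card_coe, hT]
  let e : V ≃ Fin k ⊕ Fin (n - k) := (Equiv.sumCompl (· ∈ T)).symm.trans (Equiv.sumCongr e1 e2)
  have hadj : ∀ x y : Fin k ⊕ Fin (n - k), (S n k).Adj x y ↔ x ≠ y ∧ (x.isLeft ∨ y.isLeft) := by
    rintro (x | x) (y | y) <;> simp [S, join]
  have hleft : ∀ v, (e v).isLeft = true ↔ v ∈ T := by
    intro v
    by_cases hv : v ∈ T
    · simp [e, hv]
    · simp [e, hv]
  refine ⟨⟨e, ?_⟩⟩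
  intro u v
  rw [hadj, hleft, hleft]
  by_cases huv : u = v
  · simp [huv]
  · simp [h u v huv, huv]

/-- The eigenvector is `a` on the clique and `b` on the independent set; the second equation is void
when `k = n`. -/
theorem mem_adjEigenvalues_S (n k : ℕ) (hk : 1 ≤ k) (hkn : k ≤ n) (r a b : ℝ) (ha : a ≠ 0)
    (hra : (k - 1) * a + (n - k) * b = r * a) (hrb : k < n → k * a = r * b) :
    r ∈ adjEigenvalues (S n k) := by
  classical
  rw [mem_adjEigenvalues_iff]
  have hadj : ∀ x y : Fin k ⊕ Fin (n - k), (S n k).Adj x y ↔ x ≠ y ∧ (x.isLeft ∨ y.isLeft) := by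
    rintro (x | x) (y | y) <;> simp [S, join]
  have hsum : ∀ i : Fin k, ∑ j : Fin k, (if i = j then 0 else a) = (k - 1) * a := by
    intro i
    have : ∀ j : Fin k, (if i = j then 0 else a) = a - (if i = j then a else 0) := by
      intro j; split_ifs <;> simp
    simp [this]
    ring
  refine ⟨Sum.elim (fun _ => a) (fun _ => b), fun h0 => ?_, ?_⟩
  · exact ha (by simpa using congrFun h0 (Sum.inl ⟨0, hk⟩))
  · rintro (i | i)
    · simp [Fintype.sum_sum_type, hadj, hsum, Nat.cast_sub hkn, hra]
    · have := i.2
      simp [Fintype.sum_sum_type, hadj, hrb (by omega)]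

/-! ### Degenerate orders and edge-maximal graphs -/

/-- If every nonempty vertex set spans a vertex of small degree, the vertices can be ordered so that
each has few earlier neighbours. -/
theorem exists_degenerate_order {V : Type*} [DecidableEq V] (G : SimpleGraph V)
    [DecidableRel G.Adj] (j : ℕ)
    (h : ∀ s : Finset V, s.Nonempty → ∃ v ∈ s, #{w ∈ s | G.Adj v w} ≤ j) (s : Finset V) :
    ∃ f : V → ℕ, Set.BijOn f s (Set.Iio #s) ∧
      ∀ v ∈ s, #{w ∈ s | G.Adj v w ∧ f w < f v} ≤ j := by
  induction hm : #s generalizing s with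
  | zero =>
    rw [card_eq_zero] at hm
    subst hm
    exact ⟨fun _ => 0, by simp [Set.BijOn, Set.MapsTo, Set.SurjOn, Set.Iio], by simp⟩
  | succ m ih =>
    obtain ⟨v, hv, hdeg⟩ := h s (card_pos.1 (by omega))
    obtain ⟨f, hf, hfd⟩ := ih (s.erase v) (by rw [card_erase_of_mem hv]; omega)
    have hlt : ∀ w ∈ s, w ≠ v → f w < m := fun w hw hwv => hf.mapsTo (by simp [hw, hwv])
    -- The vertex of small degree comes last, so it adds no earlier neighbour to any other vertex.
    refine ⟨Function.update f v m, ⟨?_, ?_, ?_⟩, ?_⟩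
    · intro w hw
      by_cases hwv : w = v
      · simp [hwv]
      · have := hlt w hw hwv
        simp [hwv]; omega
    · intro w hw u hu hwu
      by_cases hwv : w = v <;> by_cases huv : u = v
      · rw [hwv, huv]
      · have := hlt u hu huv
        simp [hwv, huv] at hwu; omega
      · have := hlt w hw hwv
        simp [hwv, huv] at hwu; omega
      · simp only [ne_eq, hwv, not_false_eq_true, Function.update_of_ne, huv] at hwu
        exact hf.injOn (by simpa [hwv] using hw) (by simpa [huv] using hu) hwu
    · intro i hi
      by_cases him : i = m
      · exact ⟨v, hv, by simp [him]⟩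
      · have hi' : i < m := by have : i < m + 1 := hi; omega
        obtain ⟨w, hw, rfl⟩ := hf.surjOn hi'
        simp only [coe_erase, Set.mem_sdiff, mem_coe, Set.mem_singleton_iff] at hw
        exact ⟨w, hw.1, by simp [hw.2]⟩
    · intro w hw
      by_cases hwv : w = v
      · subst hwv
        refine le_trans (card_le_card ?_) hdeg
        intro u; simp +contextual
      · refine le_trans (card_le_card ?_) (hfd w (by simp [hw, hwv]))
        intro u
        have := hlt w hw hwv
        by_cases huv : u = v
        · simp [huv, hwv]; omega
        · simp +contextual [huv, hwv]

/-- Counts edges when the vertex in position `i` has `min j i` earlier neighbours. -/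
theorem sum_range_min (j n : ℕ) (h : j ≤ n) :
    2 * ∑ i ∈ range n, ((min j i : ℕ) : ℝ) = j * (2 * n - j - 1) := by
  induction n, h using Nat.le_induction with
  | base =>
    have : ∀ m ≤ j, 2 * ∑ i ∈ range m, ((min j i : ℕ) : ℝ) = m * (m - 1) := by
      intro m
      induction m with
      | zero => simp
      | succ m ih =>
        intro hm
        rw [sum_range_succ, mul_add, ih (by omega), min_eq_right (by omega)]
        push_cast; ring
    rw [this j le_rfl]; ring
  | succ n hn ih =>
    rw [sum_range_succ, mul_add, ih, min_eq_left hn]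
    push_cast; ring

/-- A `j`-degenerate graph on more than `j ≥ 1` vertices is contained in an edge-maximal one, which
is connected, has minimum degree at least `j`, and has `j (2 n - j - 1) / 2` edges. -/
theorem exists_maximal_degenerate {V : Type*} [Fintype V] [DecidableEq V] (G : SimpleGraph V)
    [DecidableRel G.Adj] (j : ℕ) (hj : 1 ≤ j) (hjn : j < Fintype.card V)
    (h : ∀ s : Finset V, s.Nonempty → ∃ v ∈ s, #{w ∈ s | G.Adj v w} ≤ j) :
    ∃ H : SimpleGraph V, ∃ _ : DecidableRel H.Adj, G ≤ H ∧ (∀ v, j ≤ H.degree v) ∧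
      (∀ P : Set V, P.Nonempty → (∀ v ∈ P, ∀ w, H.Adj v w → w ∈ P) → ∀ v, v ∈ P) ∧
      ∑ v, (H.degree v : ℝ) = j * (2 * Fintype.card V - j - 1) := by
  obtain ⟨f, hf, hfd⟩ := exists_degenerate_order G j h univ
  set n := Fintype.card V with hn
  have hinj : Function.Injective f := fun u v huv => hf.injOn (by simp) (by simp) huv
  have hflt : ∀ v, f v < n := fun v => by simpa using hf.mapsTo (x := v) (by simp)
  have hsurj : ∀ i < n, ∃ v, f v = i := fun i hi => by
    obtain ⟨v, -, hv⟩ := hf.surjOn (show i ∈ Set.Iio #(univ : Finset V) by simpa using hi)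
    exact ⟨v, hv⟩
  have himg : ∀ i ≤ n, image f {w | f w < i} = range i := by
    intro i hi
    ext x
    simp only [mem_image, mem_filter, mem_univ, true_and, mem_range]
    constructor
    · rintro ⟨w, hw, rfl⟩; exact hw
    · intro hx
      obtain ⟨w, rfl⟩ := hsurj x (by omega)
      exact ⟨w, hx, rfl⟩
  have hcard : ∀ i ≤ n, #{w | f w < i} = i := by
    intro i hi
    rw [← card_image_of_injective _ hinj, himg i hi, card_range]
  -- Pad the earlier neighbours of each vertex to the largest size allowed; these sets define `H`.
  have hB : ∀ v, ∃ B : Finset V, ({w | G.Adj v w ∧ f w < f v} : Finset V) ⊆ B ∧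
      B ⊆ ({w | f w < f v} : Finset V) ∧ #B = min j (f v) := by
    intro v
    refine exists_subsuperset_card_eq ?_ ?_ ?_
    · intro w; simp +contextual
    · refine le_min (hfd v (mem_univ v)) ?_
      conv_rhs => rw [← hcard (f v) (hflt v).le]
      exact card_le_card (by intro w; simp +contextual)
    · rw [hcard _ (hflt v).le]; exact min_le_right _ _
  choose B hGB hBf hBc using hB
  have hBlt : ∀ v w, w ∈ B v → f w < f v := fun v w hw => by simpa using hBf v hw
  have hBsmall : ∀ v, f v ≤ j → ∀ w, f w < f v → w ∈ B v := by
    intro v hv w hw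
    have : B v = ({w | f w < f v} : Finset V) := by
      refine eq_of_subset_of_card_le (hBf v) ?_
      rw [hBc, hcard _ (hflt v).le, min_eq_right hv]
    rw [this]; simpa using hw
  let H : SimpleGraph V :=
    { Adj := fun u v => u ∈ B v ∨ v ∈ B u
      symm := ⟨fun u v huv => huv.symm⟩
      loopless := ⟨fun u hu => by
        have := hBlt u u (by simpa using hu)
        omega⟩ }
  have hdec : DecidableRel H.Adj := fun u v => inferInstanceAs (Decidable (u ∈ B v ∨ v ∈ B u))
  have hnbr : ∀ v, H.neighborFinset v = B v ∪ ({w | v ∈ B w} : Finset V) := by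
    intro v
    ext w
    simp [H, or_comm]
  have hdisj : ∀ v, Disjoint (B v) ({w | v ∈ B w} : Finset V) := by
    intro v
    rw [disjoint_left]
    intro w hw hw'
    have h1 := hBlt v w hw
    have h2 := hBlt w v (by simpa using hw')
    omega
  have hdeg : ∀ v, H.degree v = min j (f v) + #{w | v ∈ B w} := by
    intro v
    rw [← SimpleGraph.card_neighborFinset_eq_degree, hnbr, card_union_of_disjoint (hdisj v), hBc]
  refine ⟨H, hdec, ?_, ?_, ?_, ?_⟩
  · intro u v huv
    rcases lt_or_gt_of_ne (fun e : f u = f v => huv.ne (hinj e)) with hlt | hlt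
    · exact Or.inl (hGB v (by simp [huv.symm, hlt]))
    · exact Or.inr (hGB u (by simp [huv, hlt]))
  · intro v
    rw [hdeg]
    rcases le_or_gt j (f v) with hv | hv
    · omega
    -- An early vertex makes up its degree from the `j - f v` later vertices in positions up to `j`,
    -- which are joined to everything before them.
    · have hsub : ({w | f w < j + 1} : Finset V) \ ({w | f w < f v + 1} : Finset V) ⊆
          ({w | v ∈ B w} : Finset V) := by
        intro w
        simp only [mem_sdiff, mem_filter, mem_univ, true_and, not_lt]
        rintro ⟨h1, h2⟩
        exact hBsmall w (by omega) v (by omega)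
      have := (card_le_card hsub).trans' (le_card_sdiff _ _)
      rw [hcard _ (by omega), hcard _ (by omega)] at this
      omega
  · rintro P ⟨p, hp⟩ hP
    have hback : ∀ v, f v ≠ 0 → ∃ w, w ∈ B v := by
      intro v hv
      refine card_pos.1 ?_
      rw [hBc]; omega
    have hdown : ∀ m, ∀ v ∈ P, f v = m → ∃ w ∈ P, f w = 0 := by
      intro m
      induction m using Nat.strong_induction_on with
      | _ m ih =>
        intro v hv hm
        by_cases h0 : f v = 0
        · exact ⟨v, hv, h0⟩
        · obtain ⟨w, hw⟩ := hback v h0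
          exact ih (f w) (hm ▸ hBlt v w hw) w (hP v hv w (Or.inr hw)) rfl
    obtain ⟨z, hz, hz0⟩ := hdown _ p hp rfl
    have hup : ∀ m, ∀ v, f v = m → v ∈ P := by
      intro m
      induction m using Nat.strong_induction_on with
      | _ m ih =>
        intro v hm
        by_cases h0 : f v = 0
        · rwa [hinj (h0.trans hz0.symm)]
        · obtain ⟨w, hw⟩ := hback v h0
          exact hP w (ih (f w) (hm ▸ hBlt v w hw) w rfl) v (Or.inl hw)
    exact fun v => hup _ v rfl
  · have h1 : ∑ v, #{w | v ∈ B w} = ∑ v, min j (f v) := by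
      simp_rw [← hBc, card_filter]
      rw [sum_comm]
      simp
    have h2 : ∑ v, min j (f v) = ∑ i ∈ range n, min j i := by
      have : univ = ({w | f w < n} : Finset V) := by ext w; simp [hflt]
      rw [← himg n le_rfl, ← this, sum_image hinj.injOn]
    have h3 : ∑ v, H.degree v = 2 * ∑ i ∈ range n, min j i := by
      simp_rw [hdeg]
      rw [sum_add_distrib, h1, h2]; ring
    rw [← sum_range_min j n hjn.le]
    exact_mod_cast h3

/-! ### The spectral bound and its equality case -/

/-- A bound on approximate Perron vectors of connected graphs with minimum degree at least `j` and
`j (2 n - j - 1) / 2` edges, with the structure in the case of equality. -/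
theorem equality_of_le_spectral {V : Type*} [Fintype V] [DecidableEq V] (H : SimpleGraph V)
    [DecidableRel H.Adj] (j : ℕ) (hdeg : ∀ v, j ≤ H.degree v)
    (hconn : ∀ P : Set V, P.Nonempty → (∀ v ∈ P, ∀ w, H.Adj v w → w ∈ P) → ∀ v, v ∈ P)
    (hsum : ∑ v, (H.degree v : ℝ) = j * (2 * Fintype.card V - j - 1))
    (l : ℝ) (hl0 : 0 ≤ l) (hl : j * (Fintype.card V - j) ≤ l ^ 2 - (j - 1) * l)
    (y : V → ℝ) (hy0 : ∀ v, 0 ≤ y v) (hy : y ≠ 0)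
    (hly : ∀ v, l * y v ≤ ∑ w, if H.Adj v w then y w else 0) :
    (∀ v, 0 < y v) ∧ (∀ v, l * y v = ∑ w, if H.Adj v w then y w else 0) ∧
      ∀ u v, u ≠ v → ¬ H.Adj u v → H.degree v = j := by
  set n : ℝ := (Fintype.card V : ℝ) with hn
  set z : V → ℝ := fun v => ∑ w, if H.Adj v w then y w else 0 with hz
  set d : V → ℝ := fun v => H.degree v with hd
  have hdj : ∀ v, (j : ℝ) ≤ d v := fun v => by simpa [hd] using hdeg v
  have hd_eq : ∀ v, ∑ w, (if H.Adj v w then (1 : ℝ) else 0) = d v := by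
    intro v
    simp [hd, ← SimpleGraph.card_neighborFinset_eq_degree, SimpleGraph.neighborFinset_eq_filter]
  -- the defect of the `w`-th row sum of `A ^ 2 - (j - 1) A`
  set q : V → ℝ := fun w => ∑ v, if v = w ∨ H.Adj v w then 0 else d v - j with hq
  have hq_nonneg : ∀ w, 0 ≤ q w := fun w => sum_nonneg fun v _ => by
    split_ifs
    · exact le_rfl
    · linarith [hdj v]
  have hswap : ∀ c : V → ℝ, ∑ v, c v * z v = ∑ w, (∑ v, if H.Adj v w then c v else 0) * y w := by
    intro c
    simp_rw [hz, mul_sum, sum_mul]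
    rw [sum_comm]
    refine sum_congr rfl fun w _ => sum_congr rfl fun v _ => ?_
    split_ifs <;> simp
  have hrow : ∀ w, (∑ v, if H.Adj v w then d v - (j - 1) else 0) = j * (n - j) - q w := by
    intro w
    have e1 : ∀ v, (if H.Adj v w then d v - (j - 1) else 0) =
        (d v - j) - (if v = w then d v - j else 0) - (if v = w ∨ H.Adj v w then 0 else d v - j)
          + (if H.Adj w v then 1 else 0) := by
      intro v
      by_cases hvw : v = w
      · subst hvw; simp
      · by_cases ha : H.Adj v w
        · simp [hvw, ha, ha.symm]; ring
        · simp [hvw, ha, H.adj_comm w v]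
    simp_rw [e1]
    rw [sum_add_distrib, sum_sub_distrib, sum_sub_distrib, hd_eq, sum_sub_distrib, hsum]
    simp [← hn, hq]
    ring
  have hz1 : ∑ v, z v = ∑ v, d v * y v := by
    have := hswap fun _ => 1
    simp only [one_mul] at this
    rw [this]
    refine sum_congr rfl fun w _ => ?_
    rw [← hd_eq]
    simp_rw [SimpleGraph.adj_comm]
  have hmain : ∑ v, (d v - (j - 1)) * z v = j * (n - j) * ∑ v, y v - ∑ v, q v * y v := by
    rw [hswap]
    simp_rw [hrow, sub_mul]
    rw [sum_sub_distrib, mul_sum]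
  have hz2 : ∑ v, (d v - (j - 1)) * y v = ∑ v, (z v - l * y v) + (l - (j - 1)) * ∑ v, y v := by
    rw [sum_sub_distrib, hz1, mul_sum, ← sum_sub_distrib, ← sum_add_distrib]
    exact sum_congr rfl fun v _ => by ring
  have hz3 : ∑ v, (d v - (j - 1)) * (z v - l * y v) =
      ∑ v, (d v - (j - 1)) * z v - l * ∑ v, (d v - (j - 1)) * y v := by
    rw [mul_sum, ← sum_sub_distrib]
    exact sum_congr rfl fun v _ => by ring
  have hpos : ∀ v, 0 ≤ z v - l * y v := fun v => sub_nonneg.2 (hly v)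
  have hP : 0 ≤ ∑ v, (z v - l * y v) := sum_nonneg fun v _ => hpos v
  have hP' : ∀ v ∈ univ, 0 ≤ (d v - (j - 1)) * (z v - l * y v) := fun v _ =>
    mul_nonneg (by linarith [hdj v]) (hpos v)
  have hQ' : ∀ v ∈ univ, 0 ≤ q v * y v := fun v _ => mul_nonneg (hq_nonneg v) (hy0 v)
  have hY : 0 ≤ ∑ v, y v := sum_nonneg fun v _ => hy0 v
  -- Two evaluations of the entry sum of `(A - (j - 1)) A y`; all four terms are nonnegative, so
  -- each vanishes.
  have hid : ∑ v, (d v - (j - 1)) * (z v - l * y v) + l * ∑ v, (z v - l * y v)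
      + (l ^ 2 - (j - 1) * l - j * (n - j)) * ∑ v, y v + ∑ v, q v * y v = 0 := by
    rw [hz3, hmain, hz2]; ring
  have t1 := sum_nonneg hP'
  have t2 := sum_nonneg hQ'
  have t3 : 0 ≤ (l ^ 2 - (j - 1) * l - j * (n - j)) * ∑ v, y v := mul_nonneg (by linarith) hY
  have t4 := mul_nonneg hl0 hP
  have hzl : ∀ v, z v - l * y v = 0 := by
    intro v
    have := (sum_eq_zero_iff_of_nonneg hP').1 (by linarith) v (mem_univ v)
    rcases mul_eq_zero.1 this with h | h
    · linarith [hdj v]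
    · exact h
  have hqy : ∀ v, q v * y v = 0 := fun v =>
    (sum_eq_zero_iff_of_nonneg hQ').1 (by linarith) v (mem_univ v)
  have hypos : ∀ v, y v ≠ 0 := by
    -- The zero set of `y` is closed under adjacency.
    by_contra! hex
    obtain ⟨p, hp⟩ := hex
    refine hy (funext (hconn {v | y v = 0} ⟨p, hp⟩ ?_))
    intro v hv w hvw
    have h0 : z v = 0 := by
      have := hzl v
      rw [show y v = 0 from hv] at this
      linarith
    have := (sum_eq_zero_iff_of_nonneg (fun w _ => by split_ifs <;> simp [hy0])).1 h0 w (mem_univ w)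
    simpa [hvw] using this
  refine ⟨fun v => lt_of_le_of_ne (hy0 v) (hypos v).symm, fun v => by linarith [hzl v], ?_⟩
  intro u v huv hadj
  have hq0 : q u = 0 := (mul_eq_zero.1 (hqy u)).resolve_right (hypos u)
  have := (sum_eq_zero_iff_of_nonneg (fun w _ => by
    split_ifs
    · exact le_rfl
    · linarith [hdj w])).1 hq0 v (mem_univ v)
  rw [if_neg (by rintro (h | h); exacts [huv h.symm, hadj h.symm])] at this
  have : d v = j := by linarith
  simpa [hd] using this

/-- Vertices of degree other than `j` are joined to everything, and the degree sum says there are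
`j` of them. When `n = j + 1` degrees cannot single them out, but the graph is complete and any `j`
vertices serve. -/
theorem exists_clique_join_of_degree_eq {V : Type*} [Fintype V] [DecidableEq V] (H : SimpleGraph V)
    [DecidableRel H.Adj] (j : ℕ) (hjn : j < Fintype.card V) (hdeg : ∀ v, j ≤ H.degree v)
    (hsum : ∑ v, (H.degree v : ℝ) = j * (2 * Fintype.card V - j - 1))
    (h : ∀ u v, u ≠ v → ¬ H.Adj u v → H.degree v = j) :
    ∃ T : Finset V, #T = j ∧ ∀ u v, u ≠ v → (H.Adj u v ↔ u ∈ T ∨ v ∈ T) := by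
  rcases Nat.lt_or_ge (j + 1) (Fintype.card V) with hlt | hge
  · let T : Finset V := {v | H.degree v ≠ j}
    have hT : ∀ v, v ∈ T ↔ H.degree v ≠ j := by simp [T]
    have hTadj : ∀ u v, u ≠ v → v ∈ T → H.Adj u v := fun u v huv hv => by
      by_contra hn
      exact (hT v).1 hv (h u v huv hn)
    have hTdeg : ∀ v ∈ T, H.degree v = Fintype.card V - 1 := by
      intro v hv
      have : H.neighborFinset v = univ.erase v := by
        ext u
        simp only [SimpleGraph.mem_neighborFinset, mem_erase, mem_univ, and_true]
        exact ⟨fun h => h.ne.symm, fun huv => (hTadj u v huv hv).symm⟩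
      rw [← SimpleGraph.card_neighborFinset_eq_degree, this, card_erase_of_mem (mem_univ v),
        card_univ]
    have hcard : #T = j := by
      have e : ∀ v, (H.degree v : ℝ) = j + if v ∈ T then (Fintype.card V - 1 - j : ℝ) else 0 := by
        intro v
        by_cases hv : v ∈ T
        · rw [hTdeg v hv, Nat.cast_sub (by omega)]; simp [hv]
        · have : H.degree v = j := by simpa [hT] using hv
          simp [hv, this]
      simp_rw [e] at hsum
      rw [sum_add_distrib, sum_ite_mem] at hsum
      simp only [sum_const, card_univ, nsmul_eq_mul, univ_inter] at hsum
      have hlt' : (j : ℝ) + 1 < Fintype.card V := by exact_mod_cast hlt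
      have : ((#T : ℝ) - j) * (Fintype.card V - 1 - j) = 0 := by linarith
      rcases mul_eq_zero.1 this with h | h
      · exact_mod_cast sub_eq_zero.1 h
      · linarith
    refine ⟨T, hcard, fun u v huv => ⟨fun hadj => ?_, ?_⟩⟩
    · by_contra! hn
      have hu : H.degree u = j := by simpa [hT] using hn.1
      have : T = H.neighborFinset u := by
        refine eq_of_subset_of_card_le (fun w hw => ?_) ?_
        · rw [SimpleGraph.mem_neighborFinset]
          exact hTadj u w (fun e => hn.1 (e ▸ hw)) hw
        · rw [SimpleGraph.card_neighborFinset_eq_degree, hu, hcard]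
      exact hn.2 (this ▸ (SimpleGraph.mem_neighborFinset _ _ _).2 hadj)
    · rintro (hu | hv)
      · exact (hTadj v u huv.symm hu).symm
      · exact hTadj u v huv hv
  · obtain ⟨p⟩ : Nonempty V := Fintype.card_pos_iff.1 (by omega)
    have hadj : ∀ u v, u ≠ v → H.Adj u v := by
      intro u v huv
      have : H.neighborFinset u = univ.erase u := by
        refine eq_of_subset_of_card_le (fun w hw => ?_) ?_
        · rw [SimpleGraph.mem_neighborFinset] at hw
          simpa using hw.ne.symm
        · rw [SimpleGraph.card_neighborFinset_eq_degree, card_erase_of_mem (mem_univ u), card_univ]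
          exact le_trans (by omega) (hdeg u)
      rw [← SimpleGraph.mem_neighborFinset, this]
      simpa using huv.symm
    refine ⟨univ.erase p, ?_, fun u v huv => ⟨fun _ => ?_, fun _ => hadj u v huv⟩⟩
    · rw [card_erase_of_mem (mem_univ p), card_univ]; omega
    · by_cases hu : u = p
      · right; simpa using fun e => huv (hu.trans e.symm)
      · left; simpa using hu

/-- A `j`-degenerate graph whose largest eigenvalue is at least that of `S n j` is the join of a
clique of order `j` and an independent set. -/
theorem exists_clique_join_of_le_eigenvalue {V : Type*} [Fintype V] [DecidableEq V]
    (G : SimpleGraph V) [DecidableRel G.Adj] (j : ℕ) (hj : 1 ≤ j) (hjn : j < Fintype.card V)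
    (h : ∀ s : Finset V, s.Nonempty → ∃ v ∈ s, #{w ∈ s | G.Adj v w} ≤ j)
    (l : ℝ) (hmem : l ∈ adjEigenvalues G) (hl0 : 0 ≤ l)
    (hl : j * (Fintype.card V - j) ≤ l ^ 2 - (j - 1) * l) :
    ∃ T : Finset V, #T = j ∧ ∀ u v, u ≠ v → (G.Adj u v ↔ u ∈ T ∨ v ∈ T) := by
  obtain ⟨x, hx0, hx⟩ := (mem_adjEigenvalues_iff G l).1 hmem
  obtain ⟨H, _, hGH, hdeg, hconn, hsum⟩ := exists_maximal_degenerate G j hj hjn h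
  have hGabs : ∀ v, l * |x v| ≤ ∑ w, if G.Adj v w then |x w| else 0 := by
    intro v
    rw [← abs_of_nonneg hl0, ← abs_mul, ← hx v]
    refine (abs_sum_le_sum_abs _ _).trans (le_of_eq (sum_congr rfl fun w _ => ?_))
    split_ifs <;> simp
  have hle : ∀ v w, (if G.Adj v w then |x w| else 0) ≤ if H.Adj v w then |x w| else 0 := by
    intro v w
    by_cases hG : G.Adj v w
    · simp [hG, hGH hG]
    · rw [if_neg hG]
      split_ifs <;> simp
  have hHabs : ∀ v, l * |x v| ≤ ∑ w, if H.Adj v w then |x w| else 0 := fun v =>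
    (hGabs v).trans (sum_le_sum fun w _ => hle v w)
  obtain ⟨hpos, heq, hstr⟩ := equality_of_le_spectral H j hdeg hconn hsum l hl0 hl (fun v => |x v|)
    (fun v => abs_nonneg _) (fun h0 => hx0 (funext fun v => by simpa using congrFun h0 v)) hHabs
  have hHG : H = G := by
    refine le_antisymm (fun v w hvw => ?_) hGH
    by_contra hG
    -- As `|x|` is positive, an edge of `H` missing from `G` would break the equality at `v`.
    have : ∑ w, (if G.Adj v w then |x w| else 0) < ∑ w, if H.Adj v w then |x w| else 0 :=
      sum_lt_sum (fun w _ => hle v w) ⟨w, mem_univ w, by simpa [hG, hvw] using hpos w⟩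
    have := hGabs v
    have := heq v
    linarith
  obtain ⟨T, hT, hTadj⟩ := exists_clique_join_of_degree_eq H j hjn hdeg hsum hstr
  exact ⟨T, hT, hHG ▸ hTadj⟩

/-! ### From subgraphs to vertex sets, and the main theorem -/

theorem IsDegenerate.exists_card_filter_le {V : Type*} {k : ℕ} {G : SimpleGraph V}
    [DecidableRel G.Adj] (hG : IsDegenerate k G) (s : Finset V) (hs : s.Nonempty) :
    ∃ v ∈ s, #{w ∈ s | G.Adj v w} ≤ k := by
  obtain ⟨v, hv, hc⟩ := hG ((⊤ : G.Subgraph).induce s) (by simpa using hs)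
  have hv' : v ∈ s := by simpa using hv
  refine ⟨v, hv', ?_⟩
  have : ((⊤ : G.Subgraph).induce s).neighborSet v = (({w ∈ s | G.Adj v w} : Finset V) : Set V) := by
    ext w
    simp [hv']
  rw [this, Set.encard_coe_eq_coe_finsetCard] at hc
  exact_mod_cast hc

end DegenerateGraphs

open DegenerateGraphs Finset in
theorem theorem1 {V : Type*} [Fintype V] (G : SimpleGraph V) (n k : ℕ)
    (hn : Fintype.card V = n) (hkn : k ≤ n) (hG : DegenerateGraphs.IsDegenerate k G)
    (hne : ¬ Nonempty (G ≃g DegenerateGraphs.S n k)) :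
    DegenerateGraphs.mu G < DegenerateGraphs.mu (DegenerateGraphs.S n k) := by
  classical
  have hdeg := hG.exists_card_filter_le
  rcases Nat.eq_zero_or_pos k with hk0 | hk
  · subst hk0
    refine absurd (nonempty_iso_S G n 0 hn ∅ rfl fun u v huv => ?_) hne
    simp only [notMem_empty, or_self, iff_false]
    intro hadj
    obtain ⟨w, hw, hc⟩ := hdeg {u, v} (by simp)
    rw [Nat.le_zero, card_eq_zero, filter_eq_empty_iff] at hc
    simp only [mem_insert, mem_singleton] at hw
    rcases hw with rfl | rfl
    · exact hc (by simp) hadj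
    · exact hc (x := u) (by simp) hadj.symm
  have : Nonempty V := Fintype.card_pos_iff.1 (by omega)
  have : Nonempty (Fin k ⊕ Fin (n - k)) := ⟨Sum.inl ⟨0, hk⟩⟩
  by_contra! hle
  have hmem := (isGreatest_mu G).1
  have hle' : ∀ r ∈ adjEigenvalues (S n k), r ≤ mu G := fun r hr =>
    ((isGreatest_mu (S n k)).2 hr).trans hle
  have hk' : (1 : ℝ) ≤ k := by exact_mod_cast hk
  rcases hkn.eq_or_lt with hkn' | hlt
  · have hl : (k : ℝ) - 1 ≤ mu G := hle' _ (mem_adjEigenvalues_S n k hk hkn _ 1 0 one_ne_zero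
      (by ring) (fun h => absurd hkn' h.ne))
    refine hne (nonempty_iso_S G n k hn univ (by rw [card_univ, hn, hkn']) fun u v huv => ?_)
    simp only [mem_univ, or_self, iff_true]
    have h2 : 2 ≤ k := by
      have : 1 < Fintype.card V := Fintype.one_lt_card_iff.2 ⟨u, v, huv⟩
      omega
    -- The case `j < n` applies with `j = n - 1`: every graph of order `n` is `(n - 1)`-degenerate,
    -- and the join obtained is complete.
    obtain ⟨m, rfl⟩ : ∃ m, k = m + 1 := ⟨k - 1, by omega⟩
    push_cast at hl
    have hm1 : (1 : ℝ) ≤ m := by exact_mod_cast (show 1 ≤ m by omega)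
    obtain ⟨T, hT, hTadj⟩ := exists_clique_join_of_le_eigenvalue G m (by omega) (by omega)
      (fun s ⟨v, hv⟩ => ⟨v, hv, by
        have : #{w ∈ s | G.Adj v w} ≤ #(univ.erase v) := card_le_card fun w hw => by
          simpa using (mem_filter.1 hw).2.ne.symm
        rw [card_erase_of_mem (mem_univ v), card_univ] at this
        omega⟩) (mu G) hmem (by linarith) (by
        rw [hn, ← hkn']
        push_cast
        nlinarith)
    rw [hTadj u v huv]
    by_contra! hcon
    have := card_le_card (show T ⊆ (univ.erase u).erase v from fun w hw => by
      simp only [mem_erase, mem_univ, and_true]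
      exact ⟨fun e => hcon.2 (e ▸ hw), fun e => hcon.1 (e ▸ hw)⟩)
    rw [card_erase_of_mem (by simpa using huv.symm), card_erase_of_mem (mem_univ u), card_univ]
      at this
    omega
  · have hlt' : (k : ℝ) + 1 ≤ n := by exact_mod_cast hlt
    set s := √(((k : ℝ) - 1) ^ 2 + 4 * k * (n - k)) with hs
    have harg : 0 ≤ 4 * (k : ℝ) * (n - k) := by
      have : (0 : ℝ) ≤ n - k := by linarith
      positivity
    have hs2 : s ^ 2 = ((k : ℝ) - 1) ^ 2 + 4 * k * (n - k) := Real.sq_sqrt (by positivity)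
    have hsk : (k : ℝ) - 1 ≤ s := Real.le_sqrt_of_sq_le (by linarith)
    have hspos : 0 < s := Real.sqrt_pos.2 (by nlinarith [sq_nonneg ((k : ℝ) - 1)])
    -- The larger root of `r ^ 2 - (k - 1) r = k (n - k)`, with eigenvector `r` on the clique and
    -- `k` off it.
    have hr := hle' _ (mem_adjEigenvalues_S n k hk hkn ((k - 1 + s) / 2) ((k - 1 + s) / 2) k
      (by linarith) (by linear_combination (-1 / 4) * hs2) (fun _ => by ring))
    obtain ⟨T, hT, hTadj⟩ := exists_clique_join_of_le_eigenvalue G k hk (by omega) hdeg (mu G) hmem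
      (by linarith) (by
        rw [hn]
        nlinarith [mul_nonneg (sub_nonneg.2 hr) (show 0 ≤ mu G - (k - 1 - s) / 2 by linarith)])
    exact hne (nonempty_iso_S G n k hn T hT hTadj)
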